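/- Let $k,L\ge 1$ be integers. Let $(X,\mathbb{Z}^k,T)$ and $(Y,\mathbb{Z}^k,S)$ be continuous actions of $\mathbb{Z}^k$ on compact metric spaces, and suppose that $X$ is an extension of $Y$, i.e. there is a continuous equivariant surjection $\pi:X\to Y$. Assume that $S$ is free ($ny=y$ for some $y\in Y$ implies $n=0$), that $Y$ has finite Lebesgue covering dimension $\dim(Y)$, and that $\mathrm{mdim}(X)<L/2$. Here $$\mathrm{mdim}(X)=\sup_{\epsilon>0}\lim_{n\to\infty}\frac{\mathrm{Widim}_\epsilon(X,d_{[n]})}{n^k},\qquad d_{[n]}(x,y)=\max_{g\in\{0,\dots,n-1\}^k}d(gx,gy),$$ where $\mathrm{Widim}_\epsilon(X,\rho)$ is the smallest order of a finite open cover of $X$ whose members all have $\rho$-diameter at most $\epsilon$, and the order of a finite open cover $\mathcal U$ is $-1+\max_{x}\#\{U\in\mathcal U: x\in U\}$. Then there is an embedding of $(X,\mathbb{Z}^k,T)$ into the cubical shift $\bigl(([0,1]^M)^{\mathbb{Z}^k},\sigma\bigr)$, i.e. a continuous injective map $f:X\to([0,1]^M)^{\mathbb{Z}^k}$ with $f(nx)=\sigma(n,f(x))$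 for all $n\in\mathbb Z^k$ and $x\in X$, where $\sigma(m,(x_n)_n)=(x_{n+m})_n$ and $$M=1+2^k(\dim(Y)+1)L.$$ If moreover $\dim(X)<\infty$, then the same holds with $M=1+2^k(\dim(X)+1)L$. -/

import Mathlib

open Filter Topology
open scoped ENNReal unitInterval

/-! Covers, order, covering dimension and `ε`-width dimension. -/

/-- `𝒰` is a finite open cover of `X`. -/
structure IsFiniteOpenCover {X : Type*} [TopologicalSpace X] (𝒰 : Set (Set X)) : Prop where
  finite : 𝒰.Finite
  isOpen : ∀ U ∈ 𝒰, IsOpen U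
  cover : ⋃₀ 𝒰 = Set.univ

/-- The order of a cover: `-1 + max_x #{U ∈ 𝒰 : x ∈ U}`
(every point lies in at least one member of a cover; on the empty space the value is `0`). -/
noncomputable def coverOrder {X : Type*} (𝒰 : Set (Set X)) : ℕ∞ :=
  ⨆ x : X, ({U | U ∈ 𝒰 ∧ x ∈ U}.encard - 1)

/-- `β` refines `α`: every member of `β` is contained in a member of `α`. -/
def CoverRefines {X : Type*} (β α : Set (Set X)) : Prop :=
  ∀ V ∈ β, ∃ U ∈ α, V ⊆ U

/-- Lebesgue covering dimension (of a compact space):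
`sup_α min_{β refines α} ord β` over finite open covers. It is `⊤` in the infinite-dimensional
case, and `0` for the empty space. -/
noncomputable def coveringDim (X : Type*) [TopologicalSpace X] : ℕ∞ :=
  ⨆ (α : Set (Set X)) (_ : IsFiniteOpenCover α),
    ⨅ (β : Set (Set X)) (_ : IsFiniteOpenCover β) (_ : CoverRefines β α), coverOrder β

/-- `Widim_ε (X, ρ)`: the smallest order of a finite open cover of `X` all of whose members have
`ρ`-diameter at most `ε`. -/
noncomputable def widim {X : Type*} [TopologicalSpace X] (ε : ℝ) (ρ : X → X → ℝ) : ℕ∞ :=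
  ⨅ (𝒰 : Set (Set X)) (_ : IsFiniteOpenCover 𝒰)
    (_ : ∀ U ∈ 𝒰, ∀ x ∈ U, ∀ y ∈ U, ρ x y ≤ ε), coverOrder 𝒰

/-! `ℤᵏ`-actions: a continuous action of `ℤᵏ` on `X` is a `Flow (Fin k → ℤ) X`
(`ℤᵏ` carries the discrete topology). Extensions are given by `Flow.IsSemiconjugacy`, that is,
continuous equivariant surjections. -/

/-- `d_{[n]}(x, y) = max_{g ∈ {0, …, n-1}ᵏ} d(g x, g y)`. -/
noncomputable def boxDist {k : ℕ} {X : Type*} [MetricSpace X] (T : Flow (Fin k → ℤ) X) (n : ℕ)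
    (x y : X) : ℝ :=
  ⨆ g : Fin k → Fin n, dist (T (fun i => ((g i : ℕ) : ℤ)) x) (T (fun i => ((g i : ℕ) : ℤ)) y)

/-- Mean dimension `sup_{ε > 0} lim_n Widim_ε (X, d_{[n]}) / nᵏ`. The limit exists for compact `X`
(Ornstein–Weiss), so it is written as a lower limit. -/
noncomputable def meanDim {k : ℕ} {X : Type*} [MetricSpace X] (T : Flow (Fin k → ℤ) X) : ℝ≥0∞ :=
  ⨆ (ε : ℝ) (_ : 0 < ε),
    liminf (fun n : ℕ => ((widim ε (boxDist T n) : ℕ∞) : ℝ≥0∞) / (n : ℝ≥0∞) ^ k) atTop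

/-- Freeness: only `0` has a fixed point. -/
def IsFreeAction {k : ℕ} {Y : Type*} [TopologicalSpace Y] (S : Flow (Fin k → ℤ) Y) : Prop :=
  ∀ (n : Fin k → ℤ) (y : Y), S n y = y → n = 0

/-- The shift `σ` on `([0,1]^M)^{ℤᵏ}`: `m` sends `(xₙ)ₙ` to `(x_{n+m})ₙ`. -/
def cubicalShift (k M : ℕ) : Flow (Fin k → ℤ) ((Fin k → ℤ) → (Fin M → I)) where
  toFun m x := fun n => x (n + m)
  cont' := by
    refine continuous_pi fun n => ?_
    have h : Continuous fun p : (Fin k → ℤ) × ((Fin k → ℤ) → (Fin M → I)) => p.2 (n + p.1) := by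
      rw [continuous_prod_of_discrete_left]
      intro m
      exact continuous_apply (n + m)
    exact h
  map_add' m₁ m₂ x := by
    funext n
    simp [add_assoc]
  map_zero' x := by
    funext n
    simp

/-- An embedding of `ℤᵏ`-actions: a continuous injective equivariant map (for compact `X` and
Hausdorff `Z` it is automatically a homeomorphism onto its image). -/
def EmbedsInto {k : ℕ} {X Z : Type*} [TopologicalSpace X] [TopologicalSpace Z]
    (T : Flow (Fin k → ℤ) X) (R : Flow (Fin k → ℤ) Z) : Prop :=
  ∃ f : X → Z, Continuous f ∧ Function.Injective f ∧ ∀ (n : Fin k → ℤ) (x : X), f (T n x) = R n (f x)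

/-! The one extra coordinate comes from `Y`: as `S` is free and `dim Y ≤ D`, a Baire-generic real
function on `Y` separates points along orbits, because `2 D + 1` samples suffice
(`IsFreeAction.exists_separating`). The other `2 ^ k * (D + 1) * L` coordinates only have to
separate points in the same fibre of `π` (`exists_separating_fibres`).

For the fibres, `Y` carries a marker `F` whose translates by `(-N, N)ᵏ`, after `D + 1` shifts, cover
`Y` (`IsFreeAction.exists_closed_marker`). Cutting `(-N, N)ᵏ` into `2 ^ k` boxes gives `2 ^ k * (D +
1)` towers of shape `[0, N)ᵏ` covering `Y`; they are pulled back to `X`. Each tower gets its own `L`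
coordinates, so a point of its base is seen through `N ^ k * L` samples. Mean dimension below `L /
2` provides a cover, fine for `d_{[N]}`, of order `D'` with `2 D' + 1 ≤ N ^ k * L`. General position
in the nerve then perturbs the samples so that they separate points of the base up to `ε`. Points of
one fibre lie on the same level of the same tower, so one translation brings both to the base.

The marker is a greedy union of small open sets. It misses a point only if the orbit meets the
boundaries of these sets nearby; generic boundaries meet no orbit at `D + 1` distinct times, so one
of `D + 1` widely spaced shifts succeeds. -/

/-! ### Points in general position -/

/-- The points `v i` are in general position: any linear relation with coefficient sum zero which
involves at most `dim + 1` of them is trivial. -/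
def InGeneralPosition {ι J : Type*} [Fintype ι] [Fintype J] (v : ι → J → ℝ) : Prop :=
  ∀ w : ι → ℝ, {i | w i ≠ 0}.ncard ≤ Fintype.card J + 1 → ∑ i, w i = 0 → ∑ i, w i • v i = 0 → w = 0

theorem affineSpan_image_ne_top_of_card_le {ι J : Type*} [Fintype J] (v : ι → J → ℝ)
    (t : Finset ι) (ht : t.card ≤ Fintype.card J) : affineSpan ℝ (v '' t) ≠ ⊤ := by
  classical
  intro h
  rcases t.eq_empty_or_nonempty with rfl | hne
  · simp at h
  · obtain ⟨n, hn⟩ : ∃ n, t.card = n + 1 := ⟨t.card - 1, by have := hne.card_pos; omega⟩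
    have h1 := finrank_vectorSpan_image_finset_le ℝ v t hn
    have h2 : vectorSpan ℝ (v '' t) = ⊤ := by
      rw [← direction_affineSpan, h, AffineSubspace.direction_top]
    rw [Finset.coe_image, h2, finrank_top, Module.finrank_fintype_fun_eq_card] at h1
    omega

/-- Finitely many proper affine subspaces have measure zero, while a ball has positive measure. -/
theorem exists_mem_ball_forall_notMem_affineSpan {ι J : Type*} [Fintype J] (v : ι → J → ℝ)
    (s : Finset ι) (p₀ : J → ℝ) {δ : ℝ} (hδ : 0 < δ) :
    ∃ p ∈ Metric.ball p₀ δ, ∀ t ⊆ s, t.card ≤ Fintype.card J → p ∉ affineSpan ℝ (v '' t) := by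
  classical
  by_contra! h
  have hsub : Metric.ball p₀ δ ⊆
      ⋃ t ∈ s.powerset.filter (fun t => t.card ≤ Fintype.card J),
        (affineSpan ℝ (v '' (t : Set ι)) : Set (J → ℝ)) := by
    intro p hp
    obtain ⟨t, hts, hc, hpt⟩ := h p hp
    simp only [Set.mem_iUnion]
    exact ⟨t, by simp [hts, hc], hpt⟩
  have h0 : MeasureTheory.volume (⋃ t ∈ s.powerset.filter (fun t => t.card ≤ Fintype.card J),
        (affineSpan ℝ (v '' (t : Set ι)) : Set (J → ℝ))) = 0 := by
    refine (MeasureTheory.measure_biUnion_null_iff (Finset.countable_toSet _)).2 fun t ht => ?_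
    rw [Finset.mem_coe, Finset.mem_filter] at ht
    exact MeasureTheory.Measure.addHaar_affineSubspace _ _
      (affineSpan_image_ne_top_of_card_le v t ht.2)
  exact (Metric.measure_ball_pos MeasureTheory.volume p₀ hδ).ne'
    (MeasureTheory.measure_mono_null hsub h0)

theorem sum_smul_mem_affineSpan_image {ι E : Type*} [AddCommGroup E] [Module ℝ E]
    (v : ι → E) (t : Finset ι) (c : ι → ℝ) (hc : ∑ i ∈ t, c i = 1) :
    ∑ i ∈ t, c i • v i ∈ affineSpan ℝ (v '' t) := by
  classical
  have h := affineCombination_mem_affineSpan (k := ℝ) (s := Finset.univ) (w := fun i : t => c i)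
    (by rw [Finset.univ_eq_attach, Finset.sum_attach t c, hc]) (fun i : t => v i)
  rw [Finset.affineCombination_eq_linear_combination _ _ _
    (by rw [Finset.univ_eq_attach, Finset.sum_attach t c, hc]), Finset.univ_eq_attach,
    Finset.sum_attach t (fun i => c i • v i)] at h
  convert h using 2
  ext x
  simp

theorem sum_eq_add_sum_filter_support_ne {ι E : Type*} [Fintype ι] [DecidableEq ι]
    [AddCommMonoid E] (w : ι → ℝ) (a : ι) (g : ι → E) (hg : ∀ i, w i = 0 → g i = 0) :
    ∑ i, g i = g a + ∑ i ∈ Finset.univ.filter (fun i => w i ≠ 0 ∧ i ≠ a), g i := by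
  rw [← Finset.add_sum_erase _ g (Finset.mem_univ a)]
  congr 1
  symm
  refine Finset.sum_subset (fun i hi => ?_) fun i hi hit => ?_
  · simp only [Finset.mem_filter] at hi
    simp [hi.2.2]
  · apply hg
    by_contra h
    exact hit (by simp [h, Finset.ne_of_mem_erase hi])

/-- Finitely many points can be moved into general position by an arbitrarily small
perturbation. -/
theorem exists_inGeneralPosition_near {ι J : Type*} [Fintype ι] [Fintype J] (v₀ : ι → J → ℝ)
    {δ : ℝ} (hδ : 0 < δ) : ∃ v : ι → J → ℝ, (∀ i, dist (v i) (v₀ i) < δ) ∧ InGeneralPosition v := by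
  classical
  -- The points are moved one at a time, each avoiding the affine spans of at most `|J|` points
  -- already placed.
  suffices H : ∀ s : Finset ι, ∃ v : ι → J → ℝ, (∀ i, dist (v i) (v₀ i) < δ) ∧
      ∀ w : ι → ℝ, (∀ i, i ∉ s → w i = 0) → {i | w i ≠ 0}.ncard ≤ Fintype.card J + 1 →
        ∑ i, w i = 0 → ∑ i, w i • v i = 0 → w = 0 by
    obtain ⟨v, h1, h2⟩ := H Finset.univ
    exact ⟨v, h1, fun w => h2 w (by simp)⟩
  intro s
  induction s using Finset.induction_on with
  | empty => exact ⟨v₀, by simpa using fun _ => hδ, fun w hw _ _ _ => funext fun i => hw i (by simp)⟩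
  | insert a s ha ih =>
    obtain ⟨v, hv, hgp⟩ := ih
    obtain ⟨p, hp, hps⟩ := exists_mem_ball_forall_notMem_affineSpan v s (v₀ a) hδ
    refine ⟨Function.update v a p, fun i => ?_, fun w hw hcard hsum hrel => ?_⟩
    · by_cases hi : i = a
      · subst hi; simpa using hp
      · simpa [hi] using hv i
    · set t : Finset ι := Finset.univ.filter (fun i => w i ≠ 0 ∧ i ≠ a) with ht
      by_cases hwa : w a = 0
      · refine hgp w (fun i hi => ?_) hcard hsum ?_
        · by_cases hia : i = a
          · rw [hia, hwa]
          · exact hw i (by simp [hia, hi])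
        · rw [← hrel]
          refine Finset.sum_congr rfl fun i _ => ?_
          by_cases hia : i = a
          · rw [hia, hwa]; simp
          · simp [hia]
      · exfalso
        have hset : {i | w i ≠ 0} = ((insert a t : Finset ι) : Set ι) := by
          ext i
          by_cases hia : i = a
          · subst hia; simp [hwa]
          · simp [ht, hia]
        rw [hset, Set.ncard_coe_finset, Finset.card_insert_of_notMem (by simp [ht])] at hcard
        refine hps t (fun i hi => ?_) (by omega) ?_
        · simp only [ht, Finset.mem_filter] at hi
          by_contra his
          exact hi.2.1 (hw i (by simp [hi.2.2, his]))
        · have h1 := sum_eq_add_sum_filter_support_ne w a w (fun _ h => h)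
          have h2 := sum_eq_add_sum_filter_support_ne w a
            (fun i => w i • Function.update v a p i) (fun i h => by simp [h])
          rw [hsum] at h1
          rw [hrel] at h2
          have h3 : ∑ i ∈ t, w i • Function.update v a p i = ∑ i ∈ t, w i • v i := by
            refine Finset.sum_congr rfl fun i hi => ?_
            simp only [ht, Finset.mem_filter] at hi
            simp [hi.2.2]
          rw [h3] at h2
          simp only [Function.update_self] at h2
          -- Solving the relation for the new point exhibits `p` as an affine combination of the
          -- points in `t`, which the choice of `p` forbids.
          have h4 := sum_smul_mem_affineSpan_image v t (fun i => -(w a)⁻¹ * w i) (by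
            rw [← Finset.mul_sum, show ∑ i ∈ t, w i = - w a by linarith]
            field_simp)
          convert h4 using 1
          simp_rw [mul_smul]
          rw [← Finset.smul_sum, show ∑ i ∈ t, w i • v i = - (w a • p) from
            (neg_eq_of_add_eq_zero_right h2.symm).symm]
          rw [smul_neg, neg_smul, neg_neg, smul_smul, inv_mul_cancel₀ hwa, one_smul]

/-! ### Approximation through the nerve of a cover -/

theorem encard_le_of_coverOrder_le {X : Type*} {𝒰 : Set (Set X)} {D : ℕ}
    (h𝒰 : coverOrder 𝒰 ≤ D) (x : X) : {U : 𝒰 | x ∈ (U : Set X)}.encard ≤ D + 1 := by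
  have h1 : {U | U ∈ 𝒰 ∧ x ∈ U}.encard - 1 ≤ D := (le_iSup _ x).trans h𝒰
  have h2 : {U | U ∈ 𝒰 ∧ x ∈ U}.encard ≤ D + 1 := tsub_le_iff_right.1 h1
  refine le_trans (le_of_eq ?_) h2
  rw [← Function.Injective.encard_image Subtype.val_injective]
  congr 1
  ext U
  simp [and_comm]

section Nerve

variable {X J : Type*} [TopologicalSpace X] [NormalSpace X] [ParacompactSpace X] [Fintype J]

/-- A partition of unity subordinate to a finite open cover. -/
theorem exists_weights_of_isFiniteOpenCover {𝒰 : Set (Set X)} [Fintype 𝒰]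
    (h𝒰 : IsFiniteOpenCover 𝒰) : ∃ φ : 𝒰 → X → ℝ, (∀ U, Continuous (φ U)) ∧ (∀ U x, 0 ≤ φ U x) ∧
      (∀ x, ∑ U, φ U x = 1) ∧ ∀ U x, φ U x ≠ 0 → x ∈ (U : Set X) := by
  obtain ⟨f, hf⟩ := PartitionOfUnity.exists_isSubordinate (isClosed_univ (X := X))
    (fun U : 𝒰 => (U : Set X)) (fun U => h𝒰.isOpen U U.2) (by
      rw [← Set.sUnion_eq_iUnion, h𝒰.cover])
  refine ⟨fun U => f U, fun U => (f U).continuous, fun U x => f.nonneg U x, fun x => ?_,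
    fun U x hx => hf U (subset_tsupport _ hx)⟩
  rw [← finsum_eq_sum_of_fintype]
  exact f.sum_eq_one (Set.mem_univ x)

theorem dist_sum_smul_le {ι : Type*} [Fintype ι] {w : ι → ℝ} (hw0 : ∀ i, 0 ≤ w i)
    (hw1 : ∑ i, w i = 1) {v : ι → J → ℝ} {p : J → ℝ} {r : ℝ}
    (h : ∀ i, w i ≠ 0 → dist (v i) p ≤ r) : dist (∑ i, w i • v i) p ≤ r := by
  have := (convex_closedBall p r).finsum_mem (w := w) (z := v) hw0
    (by rw [finsum_eq_sum_of_fintype, hw1]) (fun i hi => h i hi)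
  rwa [finsum_eq_sum_of_fintype] at this

/-- The data of a generic nerve approximation of `ψ`. -/
theorem exists_nerve_approx {𝒰 : Set (Set X)} [Fintype 𝒰] (h𝒰 : IsFiniteOpenCover 𝒰)
    (ψ : C(X, J → ℝ)) {δ : ℝ} (hosc : ∀ U ∈ 𝒰, ∀ x ∈ U, ∀ y ∈ U, dist (ψ x) (ψ y) ≤ δ)
    (z : J → ℝ) {η : ℝ} (hη : 0 < η) :
    ∃ (φ : 𝒰 → X → ℝ) (v : 𝒰 → J → ℝ) (z' : J → ℝ), (∀ U, Continuous (φ U)) ∧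
      (∀ U x, 0 ≤ φ U x) ∧ (∀ x, ∑ U, φ U x = 1) ∧ (∀ U x, φ U x ≠ 0 → x ∈ (U : Set X)) ∧
      (∀ x, dist (∑ U, φ U x • v U) (ψ x) ≤ δ + η) ∧ dist z' z < η ∧
      InGeneralPosition (fun o : Option 𝒰 => o.elim z' v) := by
  classical
  obtain ⟨φ, hφc, hφ0, hφ1, hφs⟩ := exists_weights_of_isFiniteOpenCover h𝒰
  -- The vertex of an empty member is irrelevant, since its weight vanishes everywhere.
  let v₀ : Option 𝒰 → J → ℝ := fun o => o.elim z
    (fun U => if h : (U : Set X).Nonempty then ψ h.some else 0)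
  obtain ⟨v, hv, hgp⟩ := exists_inGeneralPosition_near v₀ hη
  refine ⟨φ, fun U => v (some U), v none, hφc, hφ0, hφ1, hφs, fun x => ?_, hv none, ?_⟩
  · refine dist_sum_smul_le (fun U => hφ0 U x) (hφ1 x) fun U hU => ?_
    have hx := hφs U x hU
    have hne : (U : Set X).Nonempty := ⟨x, hx⟩
    have h1 := hv (some U)
    simp only [v₀, Option.elim, dif_pos hne] at h1
    have h2 := hosc U U.2 _ hne.some_mem x hx
    linarith [dist_triangle (v (some U)) (ψ hne.some) (ψ x)]
  · convert hgp using 1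
    ext o
    cases o <;> rfl

/-- A map into `ℝᴶ` can be approximated by a map separating points which have no common member
of a given cover of order `D`, if `2 D + 1 ≤ |J|`. -/
theorem exists_approx_separating {𝒰 : Set (Set X)} (h𝒰 : IsFiniteOpenCover 𝒰) {D : ℕ}
    (hD : coverOrder 𝒰 ≤ D) (hJ : 2 * D + 1 ≤ Fintype.card J)
    (ψ : C(X, J → ℝ)) {δ : ℝ} (hosc : ∀ U ∈ 𝒰, ∀ x ∈ U, ∀ y ∈ U, dist (ψ x) (ψ y) ≤ δ)
    {η : ℝ} (hη : 0 < η) :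
    ∃ G : C(X, J → ℝ), (∀ x, dist (G x) (ψ x) ≤ δ + η) ∧
      ∀ x x', G x = G x' → ∃ U ∈ 𝒰, x ∈ U ∧ x' ∈ U := by
  classical
  have := h𝒰.finite.fintype
  obtain ⟨φ, v, z', hφc, hφ0, hφ1, hφs, hdist, -, hgp⟩ := exists_nerve_approx h𝒰 ψ hosc 0 hη
  refine ⟨⟨fun x => ∑ U, φ U x • v U, by fun_prop⟩, hdist, fun x x' hxx => ?_⟩
  simp only [ContinuousMap.coe_mk] at hxx
  -- The relation involves only members containing `x` or `x'`, at most `2 D + 2 ≤ |J| + 1` of them.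
  -- So all weights at `x` and `x'` agree, and any member of positive weight contains both.
  have hw := hgp (fun o => o.elim 0 (fun U => φ U x - φ U x')) ?_ ?_ ?_
  · obtain ⟨U, hU⟩ : ∃ U, φ U x ≠ 0 := by
      by_contra! h
      simpa [h] using hφ1 x
    refine ⟨U, U.2, hφs U x hU, hφs U x' ?_⟩
    have := congrFun hw (some U)
    simp only [Option.elim, Pi.zero_apply] at this
    rwa [← sub_eq_zero.1 this]
  · have hsub : {o : Option 𝒰 | (o.elim 0 (fun U => φ U x - φ U x') : ℝ) ≠ 0} ⊆
        some '' ({U : 𝒰 | x ∈ (U : Set X)} ∪ {U : 𝒰 | x' ∈ (U : Set X)}) := by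
      rintro (_ | U) hU
      · simp at hU
      · refine ⟨U, ?_, rfl⟩
        by_contra hcon
        simp only [Set.mem_union, Set.mem_ofPred_eq, not_or] at hcon
        refine hU ?_
        simp only [Option.elim]
        rw [not_not.1 (mt (hφs U x) hcon.1), not_not.1 (mt (hφs U x') hcon.2), sub_zero]
    have h1 := encard_le_of_coverOrder_le hD x
    have h2 := encard_le_of_coverOrder_le hD x'
    have h3 : (some '' ({U : 𝒰 | x ∈ (U : Set X)} ∪ {U : 𝒰 | x' ∈ (U : Set X)})).encard
        ≤ (2 * D + 2 : ℕ) := by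
      rw [Function.Injective.encard_image (Option.some_injective _)]
      refine (Set.encard_union_le _ _).trans ((add_le_add h1 h2).trans (le_of_eq ?_))
      push_cast; ring
    have h4 := (Set.encard_le_encard hsub).trans h3
    rw [← (Set.toFinite _).cast_ncard_eq] at h4
    have h5 := Nat.cast_le.1 h4
    omega
  · simp [Fintype.sum_option, Finset.sum_sub_distrib, hφ1]
  · simp [Fintype.sum_option, sub_smul, Finset.sum_sub_distrib, hxx]

/-- A map into `ℝᴶ` can be approximated by a nowhere vanishing one, if `J` has more elements than
the order of a cover on whose members the map varies little. -/
theorem exists_approx_ne_zero {𝒰 : Set (Set X)} (h𝒰 : IsFiniteOpenCover 𝒰) {D : ℕ}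
    (hD : coverOrder 𝒰 ≤ D) (hJ : D + 1 ≤ Fintype.card J)
    (ψ : C(X, J → ℝ)) {δ : ℝ} (hosc : ∀ U ∈ 𝒰, ∀ x ∈ U, ∀ y ∈ U, dist (ψ x) (ψ y) ≤ δ)
    {η : ℝ} (hη : 0 < η) :
    ∃ G : C(X, J → ℝ), (∀ x, dist (G x) (ψ x) ≤ δ + η) ∧ ∀ x, G x ≠ 0 := by
  classical
  have := h𝒰.finite.fintype
  obtain ⟨φ, v, z', hφc, hφ0, hφ1, hφs, hdist, hz, hgp⟩ :=
    exists_nerve_approx h𝒰 ψ hosc 0 (half_pos hη)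
  -- The nerve map avoids a point `z'` near `0` that is generic relative to the vertices;
  -- subtracting `z'` moves this point to `0`. A zero would be a relation among `D + 1` vertices and
  -- `z'`.
  refine ⟨⟨fun x => (∑ U, φ U x • v U) - z', by fun_prop⟩, fun x => ?_, fun x hx => ?_⟩
  · simp only [ContinuousMap.coe_mk]
    have h1 : dist ((∑ U, φ U x • v U) - z') (∑ U, φ U x • v U) = dist z' 0 := by
      simp [dist_eq_norm]
    linarith [hdist x, dist_triangle ((∑ U, φ U x • v U) - z') (∑ U, φ U x • v U) (ψ x)]
  · simp only [ContinuousMap.coe_mk] at hx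
    have hw := hgp (fun o => o.elim (-1) (fun U => φ U x)) ?_ ?_ ?_
    · simpa using congrFun hw none
    · have hsub : {o : Option 𝒰 | (o.elim (-1) (fun U => φ U x) : ℝ) ≠ 0} ⊆
          insert none (some '' {U : 𝒰 | x ∈ (U : Set X)}) := by
        rintro (_ | U) hU
        · simp
        · exact Or.inr ⟨U, hφs U x hU, rfl⟩
      have h1 := encard_le_of_coverOrder_le hD x
      have h3 : (insert none (some '' {U : 𝒰 | x ∈ (U : Set X)})).encard ≤ (D + 2 : ℕ) := by
        refine (Set.encard_insert_le _ _).trans ?_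
        rw [Function.Injective.encard_image (Option.some_injective _)]
        refine (add_le_add_left h1 1).trans (le_of_eq ?_)
        push_cast; ring
      have h4 := (Set.encard_le_encard hsub).trans h3
      rw [← (Set.toFinite _).cast_ncard_eq] at h4
      have h5 := Nat.cast_le.1 h4
      omega
    · simp [Fintype.sum_option, hφ1]
    · simp only [Fintype.sum_option, Option.elim, neg_smul, one_smul]
      rw [← hx]; abel

end Nerve

/-! ### Perturbing a function along a Rokhlin tower -/

/-- Continuous functions prescribed on disjoint closed sets near `f` can be glued to a continuous
function near `f`. -/
theorem exists_glue_near {X ι : Type*} [TopologicalSpace X] [NormalSpace X] [Finite ι]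
    {B : ι → Set X} (hB : ∀ i, IsClosed (B i)) (hdisj : ∀ i j, i ≠ j → Disjoint (B i) (B j))
    (p : ι → C(X, ℝ)) (f : C(X, ℝ)) {δ : ℝ} (hδ : 0 ≤ δ)
    (hp : ∀ i, ∀ x ∈ B i, |p i x - f x| ≤ δ) :
    ∃ g : C(X, ℝ), (∀ x, |g x - f x| ≤ δ) ∧ ∀ i, ∀ x ∈ B i, g x = p i x := by
  classical
  -- Tietze extension is applied to the difference with `f`, so that its bound `δ` survives the
  -- extension.
  let q : X → ℝ := fun x => if h : ∃ i, x ∈ B i then p h.choose x - f x else 0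
  have hq : ∀ i, ∀ x ∈ B i, q x = p i x - f x := by
    intro i x hx
    have h : ∃ i, x ∈ B i := ⟨i, hx⟩
    have hi : h.choose = i := by
      by_contra hne
      exact Set.disjoint_left.1 (hdisj _ _ hne) h.choose_spec hx
    simp only [q, dif_pos h, hi]
  have hqc : ContinuousOn q (⋃ i, B i) := by
    refine (locallyFinite_of_finite B).continuousOn_iUnion hB fun i => ?_
    exact ((p i).continuous.sub f.continuous).continuousOn.congr (hq i)
  have hq' : ∀ x : (⋃ i, B i : Set X), q x ∈ Set.Icc (-δ) δ := by
    rintro ⟨x, hx⟩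
    obtain ⟨i, hi⟩ := Set.mem_iUnion.1 hx
    simp only [hq i x hi]
    exact abs_le.1 (hp i x hi)
  let q₁ : BoundedContinuousFunction (⋃ i, B i : Set X) ℝ :=
    BoundedContinuousFunction.ofNormedAddCommGroup (fun x => q x)
      (continuousOn_iff_continuous_domRestrict.1 hqc) δ (fun x => abs_le.2 (hq' x))
  obtain ⟨r, hr, hrq⟩ :=
    BoundedContinuousFunction.exists_extension_forall_mem_Icc_of_isClosedEmbedding q₁
      (a := -δ) (b := δ) hq' (by linarith)
      (isClosed_iUnion_of_finite hB).isClosedEmbedding_subtypeVal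
  refine ⟨f + r.toContinuousMap, fun x => ?_, fun i x hx => ?_⟩
  · simpa using abs_le.2 (hr x)
  · have h1 : r x = q x := congrFun hrq ⟨x, Set.mem_iUnion.2 ⟨i, hx⟩⟩
    change f x + r x = p i x
    rw [h1, hq i x hx]; ring

section Sampling

variable {k : ℕ} {X ι J : Type*}

/-- The map `x ↦ (f_{c j} (T_{h j} x))_j`. -/
def sample [TopologicalSpace X] (T : Flow (Fin k → ℤ) X) (h : J → Fin k → ℤ) (c : J → ι)
    (f : C(X, ι → ℝ)) : C(X, J → ℝ) where
  toFun x j := f (T (h j) x) (c j)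
  continuous_toFun := by
    refine continuous_pi fun j => ?_
    have h1 : Continuous fun x => T (h j) x := T.continuous_toFun (h j)
    exact (continuous_apply (c j)).comp (f.continuous.comp h1)

theorem sample_apply [TopologicalSpace X] (T : Flow (Fin k → ℤ) X) (h : J → Fin k → ℤ) (c : J → ι)
    (f : C(X, ι → ℝ)) (x : X) (j : J) : sample T h c f x j = f (T (h j) x) (c j) := rfl

theorem continuous_sample [TopologicalSpace X] [CompactSpace X] (T : Flow (Fin k → ℤ) X)
    (h : J → Fin k → ℤ) (c : J → ι) :
    Continuous fun p : C(X, ι → ℝ) × X => sample T h c p.1 p.2 := by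
  refine continuous_pi fun j => ?_
  have h1 : Continuous fun x => T (h j) x := T.continuous_toFun (h j)
  have h2 : Continuous fun p : C(X, ι → ℝ) × X => p.1 (T (h j) p.2) := by fun_prop
  exact (continuous_apply (c j)).comp h2

/-- `A` is the base of a tower for the sampling data `h`, `c`: positions which are sampled in the
same coordinate give disjoint translates of `A`. -/
def IsTowerBase [TopologicalSpace X] (T : Flow (Fin k → ℤ) X) (h : J → Fin k → ℤ) (c : J → ι)
    (A : Set X) : Prop :=
  ∀ j j', j ≠ j' → c j = c j' → ∀ x ∈ A, ∀ x' ∈ A, T (h j) x ≠ T (h j') x'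

theorem flow_neg_apply [TopologicalSpace X] (T : Flow (Fin k → ℤ) X) (m : Fin k → ℤ) (x : X) :
    T (-m) (T m x) = x := by
  rw [← T.map_add, neg_add_cancel, T.map_zero_apply]

theorem flow_apply_neg [TopologicalSpace X] (T : Flow (Fin k → ℤ) X) (m : Fin k → ℤ) (x : X) :
    T m (T (-m) x) = x := by
  rw [← T.map_add, add_neg_cancel, T.map_zero_apply]

variable [TopologicalSpace X] [NormalSpace X] [Fintype ι] [Fintype J]

/-- Sampled values on a tower can be prescribed near the given ones. -/
theorem exists_sample_eq (T : Flow (Fin k → ℤ) X) (h : J → Fin k → ℤ) (c : J → ι) {A : Set X}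
    (hA : IsClosed A) (htow : IsTowerBase T h c A) (f : C(X, ι → ℝ)) (G : C(X, J → ℝ)) {δ : ℝ}
    (hδ : 0 ≤ δ) (hG : ∀ x, dist (G x) (sample T h c f x) ≤ δ) :
    ∃ g : C(X, ι → ℝ), (∀ x, dist (g x) (f x) ≤ δ) ∧ ∀ x ∈ A, sample T h c g x = G x := by
  have key : ∀ i : ι, ∃ g : C(X, ℝ), (∀ x, |g x - f x i| ≤ δ) ∧
      ∀ j : {j // c j = i}, ∀ x ∈ T (h j) '' A, g x = G (T (-h j) x) j := by
    intro i
    have hc : ∀ m, Continuous fun x => T m x := fun m => T.continuous_toFun m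
    -- On the level `T (h j) '' A` the new value is read off from `G` at the point of the base
    -- below; levels sharing a coordinate are disjoint.
    refine exists_glue_near (B := fun j : {j // c j = i} => T (h j) '' A)
      (fun j => ?_) (fun j j' hjj => ?_)
      (fun j => ⟨fun x => G (T (-h j) x) j, (continuous_apply _).comp
        (G.continuous.comp (hc (-h j)))⟩)
      ⟨fun x => f x i, (continuous_apply i).comp f.continuous⟩ hδ ?_
    · exact (T.toHomeomorph (h j)).isClosedMap _ hA
    · rw [Set.disjoint_left]
      rintro _ ⟨x, hx, rfl⟩ ⟨x', hx', hxx⟩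
      exact htow j' j (fun h => hjj (Subtype.ext h.symm)) (j'.2.trans j.2.symm) x' hx' x hx hxx
    · rintro j _ ⟨x, hx, rfl⟩
      have h1 := (dist_le_pi_dist _ _ j.1).trans (hG x)
      rw [Real.dist_eq, sample_apply, j.2] at h1
      simpa [flow_neg_apply] using h1
  choose g hg1 hg2 using key
  refine ⟨⟨fun x i => g i x, by fun_prop⟩, fun x => ?_, fun x hx => ?_⟩
  · exact (dist_pi_le_iff hδ).2 fun i => by simpa [Real.dist_eq] using hg1 i x
  · ext j
    have := hg2 (c j) ⟨j, rfl⟩ _ ⟨x, hx, rfl⟩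
    rw [sample_apply, ContinuousMap.coe_mk, this]
    simp [flow_neg_apply]

variable [ParacompactSpace X]

/-- The sampled map is perturbed first, as an arbitrary map into `ℝᴶ`; the tower then realises the
perturbation over `A` by a function on `X`. -/
theorem exists_sample_separating (T : Flow (Fin k → ℤ) X) (h : J → Fin k → ℤ) (c : J → ι)
    {A : Set X} (hA : IsClosed A) (htow : IsTowerBase T h c A) (f : C(X, ι → ℝ))
    {𝒰 : Set (Set X)} (h𝒰 : IsFiniteOpenCover 𝒰) {D : ℕ} (hD : coverOrder 𝒰 ≤ D)
    (hJ : 2 * D + 1 ≤ Fintype.card J) {δ : ℝ} (hδ : 0 < δ)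
    (hosc : ∀ U ∈ 𝒰, ∀ x ∈ U, ∀ y ∈ U, dist (sample T h c f x) (sample T h c f y) ≤ δ) :
    ∃ g : C(X, ι → ℝ), (∀ x, dist (g x) (f x) ≤ 2 * δ) ∧ ∀ x ∈ A, ∀ x' ∈ A,
      sample T h c g x = sample T h c g x' → ∃ U ∈ 𝒰, x ∈ U ∧ x' ∈ U := by
  obtain ⟨G, hG1, hG2⟩ := exists_approx_separating h𝒰 hD hJ (sample T h c f) hosc hδ
  obtain ⟨g, hg1, hg2⟩ := exists_sample_eq T h c hA htow f G (by linarith) hG1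
  refine ⟨g, fun x => (hg1 x).trans (by linarith), fun x hx x' hx' hxx => hG2 x x' ?_⟩
  rw [← hg2 x hx, ← hg2 x' hx', hxx]

theorem exists_sample_ne_zero (T : Flow (Fin k → ℤ) X) (h : J → Fin k → ℤ) (c : J → ι)
    {A : Set X} (hA : IsClosed A) (htow : IsTowerBase T h c A) (f : C(X, ι → ℝ))
    {𝒰 : Set (Set X)} (h𝒰 : IsFiniteOpenCover 𝒰) {D : ℕ} (hD : coverOrder 𝒰 ≤ D)
    (hJ : D + 1 ≤ Fintype.card J) {δ : ℝ} (hδ : 0 < δ)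
    (hosc : ∀ U ∈ 𝒰, ∀ x ∈ U, ∀ y ∈ U, dist (sample T h c f x) (sample T h c f y) ≤ δ) :
    ∃ g : C(X, ι → ℝ), (∀ x, dist (g x) (f x) ≤ 2 * δ) ∧ ∀ x ∈ A, sample T h c g x ≠ 0 := by
  obtain ⟨G, hG1, hG2⟩ := exists_approx_ne_zero h𝒰 hD hJ (sample T h c f) hosc hδ
  obtain ⟨g, hg1, hg2⟩ := exists_sample_eq T h c hA htow f G (by linarith) hG1
  exact ⟨g, fun x => (hg1 x).trans (by linarith), fun x hx => hg2 x hx ▸ hG2 x⟩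

end Sampling

/-! ### Genericity on spaces of finite covering dimension -/

theorem exists_cover_of_coveringDim_le {X Z : Type*} [TopologicalSpace X] [CompactSpace X]
    [PseudoMetricSpace Z] {D : ℕ} (hD : coveringDim X ≤ D) (ψ : C(X, Z)) {δ : ℝ} (hδ : 0 < δ) :
    ∃ 𝒰 : Set (Set X), IsFiniteOpenCover 𝒰 ∧ coverOrder 𝒰 ≤ D ∧
      ∀ U ∈ 𝒰, ∀ x ∈ U, ∀ y ∈ U, dist (ψ x) (ψ y) ≤ δ := by
  obtain ⟨t, ht⟩ := isCompact_univ.elim_finite_subcover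
    (fun x : X => ψ ⁻¹' Metric.ball (ψ x) (δ / 2))
    (fun x => Metric.isOpen_ball.preimage ψ.continuous)
    (fun x _ => Set.mem_iUnion.2 ⟨x, by simpa using hδ⟩)
  let α : Set (Set X) := (fun x : X => ψ ⁻¹' Metric.ball (ψ x) (δ / 2)) '' t
  have hα : IsFiniteOpenCover α := by
    refine ⟨t.finite_toSet.image _, ?_, ?_⟩
    · rintro _ ⟨x, -, rfl⟩
      exact Metric.isOpen_ball.preimage ψ.continuous
    · rw [Set.sUnion_image]
      exact Set.univ_subset_iff.1 ht
  have h1 : (⨅ (β : Set (Set X)) (_ : IsFiniteOpenCover β) (_ : CoverRefines β α), coverOrder β)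
      ≤ D := (le_iSup₂ (f := fun (α : Set (Set X)) (_ : IsFiniteOpenCover α) =>
        ⨅ (β : Set (Set X)) (_ : IsFiniteOpenCover β) (_ : CoverRefines β α), coverOrder β)
        α hα).trans hD
  -- A strict bound by `D + 1` yields a witness for the infimum, and integrality returns the bound
  -- `D`.
  have h2 := lt_of_le_of_lt h1 (show (D : ℕ∞) < (D + 1 : ℕ) by exact_mod_cast D.lt_succ_self)
  simp only [iInf_lt_iff] at h2
  obtain ⟨β, hβ, hβα, hord⟩ := h2
  refine ⟨β, hβ, Order.le_of_lt_add_one (by exact_mod_cast hord), fun V hV x hx y hy => ?_⟩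
  obtain ⟨_, ⟨z, -, rfl⟩, hVz⟩ := hβα V hV
  have hx' := hVz hx
  have hy' := hVz hy
  simp only [Set.mem_preimage, Metric.mem_ball] at hx' hy'
  linarith [dist_triangle_right (ψ x) (ψ y) (ψ z)]

/-- An open condition which holds at every point of a compact set is an open condition. -/
theorem isOpen_setOf_forall_mem_of_isCompact {F P : Type*} [TopologicalSpace F]
    [TopologicalSpace P] {K : Set P} (hK : IsCompact K) {R : F → P → Prop}
    (hR : IsOpen {q : F × P | R q.1 q.2}) : IsOpen {f | ∀ p ∈ K, R f p} := by
  rw [isOpen_iff_eventually] at hR ⊢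
  exact fun f hf => hK.eventually_forall_of_forall_eventually fun p hp => hR (f, p) (hf p hp)

theorem dense_continuousMap_iff {X E : Type*} [TopologicalSpace X] [CompactSpace X]
    [PseudoMetricSpace E] {s : Set C(X, E)} :
    Dense s ↔ ∀ f : C(X, E), ∀ δ > 0, ∃ g ∈ s, ∀ x, dist (g x) (f x) ≤ δ := by
  rw [Metric.dense_iff]
  constructor
  · intro h f δ hδ
    obtain ⟨g, hg, hgs⟩ := h f δ hδ
    exact ⟨g, hgs, (ContinuousMap.dist_le hδ.le).1 (Metric.mem_ball.1 hg).le⟩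
  · intro h f δ hδ
    obtain ⟨g, hgs, hg⟩ := h f (δ / 2) (half_pos hδ)
    refine ⟨g, ?_, hgs⟩
    rw [Metric.mem_ball]
    exact lt_of_le_of_lt ((ContinuousMap.dist_le (half_pos hδ).le).2 hg) (half_lt_self hδ)

section Generic

variable {k : ℕ} {Y ι J : Type*} [MetricSpace Y] [CompactSpace Y] [Fintype ι] [Fintype J]

theorem dense_sample_ne (S : Flow (Fin k → ℤ) Y) (h : J → Fin k → ℤ) (c : J → ι) {A B : Set Y}
    (hA : IsClosed A) (hB : IsClosed B) (hAB : Disjoint A B) (htow : IsTowerBase S h c (A ∪ B))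
    {D : ℕ} (hD : coveringDim Y ≤ D) (hJ : 2 * D + 1 ≤ Fintype.card J) :
    Dense {f : C(Y, ι → ℝ) | ∀ x ∈ A, ∀ y ∈ B, sample S h c f x ≠ sample S h c f y} := by
  rw [dense_continuousMap_iff]
  intro f δ hδ
  obtain ⟨r, hr, hdist⟩ : ∃ r > 0, ∀ x ∈ A, ∀ y ∈ B, r < dist x y := by
    obtain ⟨r, hr, h⟩ := hAB.exists_thickenings hA.isCompact hB
    refine ⟨r / 2, half_pos hr, fun x hx y hy => lt_of_not_ge fun hle => ?_⟩
    refine Set.disjoint_left.1 h ?_ (Metric.self_subset_thickening hr _ hy)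
    exact Metric.mem_thickening_iff.2 ⟨x, hx, by rw [dist_comm]; linarith⟩
  -- Pairing with the identity makes the members both small in `Y`, so none meets both `A` and `B`,
  -- and of small oscillation for the samples.
  obtain ⟨𝒰, h𝒰, hord, hosc⟩ := exists_cover_of_coveringDim_le hD
    ((ContinuousMap.id Y).prodMk (sample S h c f)) (lt_min hr (half_pos hδ))
  obtain ⟨g, hg1, hg2⟩ := exists_sample_separating S h c (hA.union hB) htow f h𝒰 hord hJ
    (half_pos hδ) (fun U hU x hx y hy => (le_max_right _ _).trans
      ((hosc U hU x hx y hy).trans (min_le_right _ _)))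
  refine ⟨g, fun x hx y hy hxy => ?_, fun x => (hg1 x).trans (by linarith)⟩
  obtain ⟨U, hU, hxU, hyU⟩ := hg2 x (Or.inl hx) y (Or.inr hy) hxy
  have h1 : dist x y ≤ r := (le_max_left _ _).trans
    ((hosc U hU x hxU y hyU).trans (min_le_left _ _))
  exact absurd (hdist x hx y hy) (not_lt.2 h1)

theorem dense_sample_ne_zero (S : Flow (Fin k → ℤ) Y) (h : J → Fin k → ℤ) (c : J → ι) {A : Set Y}
    (hA : IsClosed A) (htow : IsTowerBase S h c A)
    {D : ℕ} (hD : coveringDim Y ≤ D) (hJ : D + 1 ≤ Fintype.card J) :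
    Dense {f : C(Y, ι → ℝ) | ∀ x ∈ A, sample S h c f x ≠ 0} := by
  rw [dense_continuousMap_iff]
  intro f δ hδ
  obtain ⟨𝒰, h𝒰, hord, hosc⟩ := exists_cover_of_coveringDim_le hD (sample S h c f) (half_pos hδ)
  obtain ⟨g, hg1, hg2⟩ := exists_sample_ne_zero S h c hA htow f h𝒰 hord hJ (half_pos hδ) hosc
  exact ⟨g, hg2, fun x => (hg1 x).trans (by linarith)⟩

end Generic

/-- A closed neighbourhood of a finite set on which the sampling positions of the set are
distinct is a tower base. -/
theorem exists_closedBall_isTowerBase {k : ℕ} {Y ι J : Type*} [MetricSpace Y] [Finite J]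
    (S : Flow (Fin k → ℤ) Y) (h : J → Fin k → ℤ) (c : J → ι)
    {P : Set Y} (hP : P.Finite) (htow : IsTowerBase S h c P) :
    ∃ r > 0, IsTowerBase S h c (⋃ y ∈ P, Metric.closedBall y r) := by
  have key : ∀ᶠ r in 𝓝[>] (0 : ℝ), ∀ j j' : J, ∀ y ∈ P, ∀ y' ∈ P, j ≠ j' → c j = c j' →
      ∀ x ∈ Metric.closedBall y r, ∀ x' ∈ Metric.closedBall y' r, S (h j) x ≠ S (h j') x' := by
    rw [eventually_all]
    intro j
    rw [eventually_all]
    intro j'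
    rw [eventually_all_finite hP]
    intro y hy
    rw [eventually_all_finite hP]
    intro y' hy'
    by_cases hj : j ≠ j' ∧ c j = c j'
    · have hc : ∀ m, Continuous fun x => S m x := fun m => S.continuous_toFun m
      have hopen : IsOpen {q : Y × Y | S (h j) q.1 ≠ S (h j') q.2} :=
        isOpen_ne_fun ((hc (h j)).comp continuous_fst) ((hc (h j')).comp continuous_snd)
      obtain ⟨r, hr, hsub⟩ := Metric.nhds_basis_closedBall.mem_iff.1
        (hopen.mem_nhds (x := (y, y')) (htow j j' hj.1 hj.2 y hy y' hy'))
      filter_upwards [Ioc_mem_nhdsGT hr] with r' hr' _ _ x hx x' hx'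
      refine hsub (a := (x, x')) ?_
      rw [← closedBall_prod_same]
      exact ⟨Metric.closedBall_subset_closedBall hr'.2 hx,
        Metric.closedBall_subset_closedBall hr'.2 hx'⟩
    · exact Eventually.of_forall fun r h1 h2 => absurd ⟨h1, h2⟩ hj
  obtain ⟨r, hr, hr0⟩ := (key.and self_mem_nhdsWithin).exists
  refine ⟨r, hr0, fun j j' hjj hc x hx x' hx' => ?_⟩
  simp only [Set.mem_iUnion] at hx hx'
  obtain ⟨y, hy, hxy⟩ := hx
  obtain ⟨y', hy', hxy'⟩ := hx'
  exact hr j j' y hy y' hy' hjj hc x hxy x' hxy'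

/-! ### Free actions on finite-dimensional spaces -/

theorem IsTowerBase.mono {k : ℕ} {X ι J : Type*} [TopologicalSpace X] {T : Flow (Fin k → ℤ) X}
    {h : J → Fin k → ℤ} {c : J → ι} {A B : Set X} (hB : IsTowerBase T h c B) (hAB : A ⊆ B) :
    IsTowerBase T h c A :=
  fun j j' hj hc x hx x' hx' => hB j j' hj hc x (hAB hx) x' (hAB hx')

theorem IsFreeAction.injective {k : ℕ} {Y : Type*} [TopologicalSpace Y]
    {S : Flow (Fin k → ℤ) Y} (hS : IsFreeAction S) (y : Y) : Function.Injective fun m => S m y := by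
  intro m m' h
  have h1 : S (-m' + m) y = y := by
    rw [S.map_add]
    exact (congrArg (S (-m')) h).trans (flow_neg_apply S m' y)
  have h2 := hS _ _ h1
  exact (neg_add_eq_zero.1 h2).symm

section Free

variable {k : ℕ} {Y : Type*} [MetricSpace Y]

/-- Sampling times along which the orbits of two distinct points do not meet. -/
theorem IsFreeAction.exists_isTowerBase_pair {S : Flow (Fin k → ℤ) Y} (hS : IsFreeAction S)
    (hk : 0 < k) (D : ℕ) (y y' : Y) :
    ∃ h : Fin D → Fin k → ℤ, IsTowerBase S h (fun _ => ()) {y, y'} := by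
  -- By freeness at most one `m` takes `y` to `y'`. Sampling times spaced by more than its first
  -- coordinate avoid it.
  obtain ⟨q, hq0, hq⟩ : ∃ q : ℤ, 0 < q ∧ ∀ m : Fin k → ℤ, S m y = y' → |m ⟨0, hk⟩| < q := by
    by_cases h : ∃ m, S m y = y'
    · obtain ⟨m, hm⟩ := h
      refine ⟨|m ⟨0, hk⟩| + 1, by positivity, fun m' hm' => ?_⟩
      rw [hS.injective y (hm'.trans hm.symm)]
      exact lt_add_one _
    · exact ⟨1, one_pos, fun m hm => absurd ⟨m, hm⟩ h⟩
  let h : Fin D → Fin k → ℤ := fun i => Pi.single ⟨0, hk⟩ ((i : ℕ) * q)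
  have hinj : Function.Injective h := by
    intro i j hij
    have h1 := Pi.single_injective _ hij
    have h2 := mul_right_cancel₀ hq0.ne' h1
    exact Fin.ext (by exact_mod_cast h2)
  have hmixed : ∀ i j, i ≠ j → S (h i) y ≠ S (h j) y' := by
    intro i j hij heq
    have h1 : S (-h j + h i) y = y' := by
      rw [S.map_add, heq, flow_neg_apply]
    have h2 := hq _ h1
    simp only [h, Pi.add_apply, Pi.neg_apply, Pi.single_eq_same] at h2
    rw [show -((j : ℕ) * q) + (i : ℕ) * q = ((i : ℕ) - (j : ℕ) : ℤ) * q by ring, abs_mul,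
      abs_of_pos hq0] at h2
    have h3 : ((i : ℕ) - (j : ℕ) : ℤ) = 0 := Int.abs_lt_one_iff.1 (by nlinarith)
    exact hij (Fin.ext (by omega))
  refine ⟨h, fun i j hij _ x hx x' hx' => ?_⟩
  rcases hx with rfl | rfl <;> rcases hx' with rfl | rfl
  · exact fun e => hij (hinj (hS.injective _ e))
  · exact hmixed i j hij
  · exact (hmixed j i hij.symm).symm
  · exact fun e => hij (hinj (hS.injective _ e))

/-- A greedy choice of a set with disjoint translates out of a finite family of such sets. -/
theorem exists_greedy_union (S : Flow (Fin k → ℤ) Y) {N : ℕ} (hN : 0 < N) {ι : Type*}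
    (V : ι → Set Y) (hV : ∀ i, IsOpen (V i))
    (hdisj : ∀ i, ∀ g : Fin k → ℤ, (∀ a, |g a| < N) → g ≠ 0 → ∀ y ∈ V i, S g y ∉ V i)
    (s : Finset ι) :
    ∃ W : Set Y, IsOpen W ∧
      (∀ g : Fin k → ℤ, (∀ a, |g a| < N) → g ≠ 0 → ∀ y ∈ W, S g y ∉ W) ∧
      (∀ y ∈ frontier W, ∃ i, ∃ g : Fin k → ℤ, (∀ a, |g a| ≤ s.card * N) ∧
        S g y ∈ frontier (V i)) ∧
      ∀ i ∈ s, ∀ y ∈ V i, (∃ g : Fin k → ℤ, (∀ a, |g a| < N) ∧ S g y ∈ W) ∨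
        ∃ i, ∃ g : Fin k → ℤ, (∀ a, |g a| ≤ s.card * N) ∧ S g y ∈ frontier (V i) := by
  classical
  induction s using Finset.induction_on with
  | empty => exact ⟨∅, isOpen_empty, by simp, by simp, by simp⟩
  | insert a s ha ih =>
    obtain ⟨W, hWo, hWd, hWf, hWc⟩ := ih
    have hS : ∀ m, Continuous fun x => S m x := fun m => S.continuous_toFun m
    have hfin : {g : Fin k → ℤ | ∀ a, |g a| < N}.Finite := by
      refine (Set.finite_Icc (fun _ => -(N : ℤ)) (fun _ => (N : ℤ))).subset fun g hg => ?_
      exact ⟨fun a => (abs_lt.1 (hg a)).1.le, fun a => (abs_lt.1 (hg a)).2.le⟩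
    let E : Set Y := ⋃ g ∈ {g : Fin k → ℤ | ∀ a, |g a| < N}, (fun y => S g y) ⁻¹' closure W
    have hE : IsClosed E := hfin.isClosed_biUnion fun g _ => isClosed_closure.preimage (hS g)
    have hmemE : ∀ y, y ∈ E ↔ ∃ g : Fin k → ℤ, (∀ a, |g a| < N) ∧ S g y ∈ closure W := by
      intro y
      simp [E]
    -- Removing the closed set `E` keeps the new piece open. The cost is confined to points reaching
    -- the frontier of `W` but not `W`; from there a frontier of some `V i` is reached, which
    -- enlarges the range by `N`.
    have hfr : ∀ y ∈ E, (∀ g : Fin k → ℤ, (∀ a, |g a| < N) → S g y ∉ W) →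
        ∃ i, ∃ g : Fin k → ℤ, (∀ b, |g b| ≤ (insert a s).card * N) ∧ S g y ∈ frontier (V i) := by
      intro y hy hyW
      obtain ⟨g, hg, hgy⟩ := (hmemE y).1 hy
      obtain ⟨i, g', hg', hy'⟩ := hWf (S g y) (by
        rw [hWo.frontier_eq]; exact ⟨hgy, hyW g hg⟩)
      refine ⟨i, g' + g, fun b => ?_, by rwa [S.map_add]⟩
      rw [Finset.card_insert_of_notMem ha]
      push_cast
      have h1 := abs_add_le (g' b) (g b)
      have h2 := hg' b
      have h3 := hg b
      simp only [Pi.add_apply]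
      linarith
    have hlift : ∀ y, (∃ i, ∃ g : Fin k → ℤ, (∀ b, |g b| ≤ s.card * N) ∧ S g y ∈ frontier (V i)) →
        ∃ i, ∃ g : Fin k → ℤ, (∀ b, |g b| ≤ (insert a s).card * N) ∧ S g y ∈ frontier (V i) := by
      rintro y ⟨i, g, hg, hy⟩
      refine ⟨i, g, fun b => (hg b).trans ?_, hy⟩
      rw [Finset.card_insert_of_notMem ha]
      push_cast
      nlinarith
    have hzero : ∀ b : Fin k, |(0 : Fin k → ℤ) b| < N := by simpa using fun _ => hN
    refine ⟨W ∪ V a \ E, hWo.union ((hV a).sdiff hE), ?_, ?_, ?_⟩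
    · rintro g hg hg0 y (hy | ⟨hy, hyE⟩) (hgy | ⟨hgy, hgyE⟩)
      · exact hWd g hg hg0 y hy hgy
      · refine hgyE ((hmemE _).2 ⟨-g, by simpa using hg, ?_⟩)
        rw [flow_neg_apply]
        exact subset_closure hy
      · exact hyE ((hmemE _).2 ⟨g, hg, subset_closure hgy⟩)
      · exact hdisj a g hg hg0 y hy hgy
    · intro y hy
      rw [(hWo.union ((hV a).sdiff hE)).frontier_eq, closure_union] at hy
      obtain ⟨hyc, hyn⟩ := hy
      rw [Set.mem_union, not_or] at hyn
      rcases hyc with hyc | hyc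
      · exact hlift y (hWf y (by rw [hWo.frontier_eq]; exact ⟨hyc, hyn.1⟩))
      · by_cases hyV : y ∈ V a
        · have hyE : y ∈ E := by
            by_contra h
            exact hyn.2 ⟨hyV, h⟩
          refine hfr y hyE fun g hg hgW => ?_
          -- If `S g y` were in the open set `W`, nearby points of `V a \ E` would also be sent into
          -- `W`, hence lie in `E`.
          obtain ⟨z, hz1, hz2⟩ := mem_closure_iff.1 hyc _ (hWo.preimage (hS g)) hgW
          exact hz2.2 ((hmemE z).2 ⟨g, hg, subset_closure hz1⟩)
        · refine ⟨a, 0, fun b => by simp, ?_⟩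
          rw [S.map_zero_apply, (hV a).frontier_eq]
          exact ⟨closure_mono Set.sdiff_subset hyc, hyV⟩
    · intro i hi y hy
      by_cases hyW : ∃ g : Fin k → ℤ, (∀ b, |g b| < N) ∧ S g y ∈ W
      · obtain ⟨g, hg, hgy⟩ := hyW
        exact Or.inl ⟨g, hg, Or.inl hgy⟩
      · rcases Finset.mem_insert.1 hi with rfl | hi
        · by_cases hyE : y ∈ E
          · exact Or.inr (hfr y hyE fun g hg h => hyW ⟨g, hg, h⟩)
          · exact Or.inl ⟨0, hzero, Or.inr (by rw [S.map_zero_apply]; exact ⟨hy, hyE⟩)⟩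
        · exact Or.inr (hlift y ((hWc i hi y hy).resolve_left hyW))

variable [CompactSpace Y]

/-- A free `ℤᵏ`-action on a finite-dimensional compact metric space has a real function which
separates points along orbits. -/
theorem IsFreeAction.exists_separating {S : Flow (Fin k → ℤ) Y} (hS : IsFreeAction S)
    (hk : 0 < k) {D : ℕ} (hD : coveringDim Y ≤ D) :
    ∃ f : C(Y, Unit → ℝ), ∀ y y', (∀ m, f (S m y) = f (S m y')) → y = y' := by
  -- One open dense set serves a whole neighbourhood of a pair; countably many neighbourhoods cover
  -- the complement of the diagonal, so Baire applies.
  have key : ∀ p : Y × Y, p.1 ≠ p.2 → ∃ N ∈ 𝓝 p, ∃ O : Set C(Y, Unit → ℝ), IsOpen O ∧ Dense O ∧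
      ∀ f ∈ O, ∀ q ∈ N, ∃ m, f (S m q.1) ≠ f (S m q.2) := by
    rintro ⟨y, y'⟩ hne
    obtain ⟨h, hh⟩ := hS.exists_isTowerBase_pair hk (2 * D + 1) y y'
    obtain ⟨r, hr, htow⟩ := exists_closedBall_isTowerBase S h _ (Set.toFinite _) hh
    have hdpos : 0 < dist y y' := dist_pos.2 hne
    obtain ⟨ρ, hρ, hρr, hρd⟩ : ∃ ρ, 0 < ρ ∧ ρ ≤ r ∧ ρ < dist y y' / 2 :=
      ⟨min r (dist y y' / 3), by positivity, min_le_left _ _,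
        (min_le_right _ _).trans_lt (by linarith)⟩
    have hdisj : Disjoint (Metric.closedBall y ρ) (Metric.closedBall y' ρ) :=
      Metric.closedBall_disjoint_closedBall (by linarith)
    refine ⟨Metric.closedBall y ρ ×ˢ Metric.closedBall y' ρ,
      prod_mem_nhds (Metric.closedBall_mem_nhds _ hρ) (Metric.closedBall_mem_nhds _ hρ),
      {f | ∀ q ∈ Metric.closedBall y ρ ×ˢ Metric.closedBall y' ρ,
        sample S h (fun _ => ()) f q.1 ≠ sample S h (fun _ => ()) f q.2}, ?_, ?_, ?_⟩
    · refine isOpen_setOf_forall_mem_of_isCompact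
        (Metric.isClosed_closedBall.prod Metric.isClosed_closedBall).isCompact
        (R := fun f q => sample S h (fun _ => ()) f q.1 ≠ sample S h (fun _ => ()) f q.2) ?_
      have hc := continuous_sample S h (fun _ => ())
      exact isOpen_ne_fun
        (hc.comp (continuous_fst.prodMk (continuous_fst.comp continuous_snd)))
        (hc.comp (continuous_fst.prodMk (continuous_snd.comp continuous_snd)))
    · have := dense_sample_ne S h (fun _ => ()) Metric.isClosed_closedBall
        Metric.isClosed_closedBall hdisj (htow.mono ?_) hD (by simp)
      · refine Dense.mono (fun f hf q hq => ?_) this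
        exact hf _ hq.1 _ hq.2
      · refine Set.union_subset ?_ ?_
        · exact (Metric.closedBall_subset_closedBall hρr).trans
            (Set.subset_biUnion_of_mem (u := fun y => Metric.closedBall y r) (by simp))
        · exact (Metric.closedBall_subset_closedBall hρr).trans
            (Set.subset_biUnion_of_mem (u := fun y => Metric.closedBall y r) (by simp))
    · intro f hf q hq
      by_contra! hcon
      exact hf q hq (funext fun j => congrFun (hcon (h j)) ())
  choose! N hN O hO hOd hsep using key
  obtain ⟨t, htsub, htc, ht⟩ := TopologicalSpace.countable_cover_nhdsWithin
    (s := {p : Y × Y | p.1 ≠ p.2}) (f := N) fun p hp => mem_nhdsWithin_of_mem_nhds (hN p hp)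
  obtain ⟨f, hf⟩ := (dense_biInter_of_isOpen (fun p hp => hO p (htsub hp)) htc
    (fun p hp => hOd p (htsub hp))).nonempty
  refine ⟨f, fun y y' hyy => ?_⟩
  by_contra hne
  have hy : (y, y') ∈ {p : Y × Y | p.1 ≠ p.2} := hne
  obtain ⟨p, hp, hyp⟩ := Set.mem_iUnion₂.1 (ht hy)
  obtain ⟨m, hm⟩ := hsep p (htsub hp) f (Set.mem_iInter₂.1 hf p hp) _ hyp
  exact hm (hyy m)

/-- For generic functions, no orbit meets the zero sets at `D + 1` distinct times. -/
theorem IsFreeAction.dense_forall_exists_ne_zero {S : Flow (Fin k → ℤ) Y} (hS : IsFreeAction S)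
    {D : ℕ} (hD : coveringDim Y ≤ D) {ι : Type*} [Fintype ι] :
    Dense {f : C(Y, ι → ℝ) | ∀ h : Fin (D + 1) → Fin k → ℤ, Function.Injective h →
      ∀ c : Fin (D + 1) → ι, ∀ y, ∃ l, f (S (h l) y) (c l) ≠ 0} := by
  have key : ∀ h : Fin (D + 1) → Fin k → ℤ, Function.Injective h → ∀ (c : Fin (D + 1) → ι) (y : Y),
      ∃ N ∈ 𝓝 y, ∃ O : Set C(Y, ι → ℝ), IsOpen O ∧ Dense O ∧
        ∀ f ∈ O, ∀ x ∈ N, ∃ l, f (S (h l) x) (c l) ≠ 0 := by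
    intro h hh c y
    have hy : IsTowerBase S h c {y} := by
      rintro j j' hj - x rfl x' rfl
      exact fun e => hj (hh (hS.injective _ e))
    obtain ⟨r, hr, htow⟩ := exists_closedBall_isTowerBase S h _ (Set.toFinite _) hy
    rw [Set.biUnion_singleton] at htow
    refine ⟨_, Metric.closedBall_mem_nhds y hr,
      {f | ∀ x ∈ Metric.closedBall y r, sample S h c f x ≠ 0}, ?_,
      dense_sample_ne_zero S h c Metric.isClosed_closedBall htow hD (by simp), ?_⟩
    · exact isOpen_setOf_forall_mem_of_isCompact Metric.isClosed_closedBall.isCompact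
        (R := fun f x => sample S h c f x ≠ 0)
        (isOpen_ne_fun (continuous_sample S h c) continuous_const)
    · intro f hf x hx
      exact Function.ne_iff.1 (hf x hx)
  choose! N hN O hO hOd hsep using key
  have hcov := fun h hh c => TopologicalSpace.countable_cover_nhds (fun y => hN h hh c y)
  choose! t htc ht using hcov
  have hdense : Dense (⋂ q ∈ {q : (Fin (D + 1) → Fin k → ℤ) × (Fin (D + 1) → ι) |
      Function.Injective q.1}, ⋂ y ∈ t q.1 q.2, O q.1 q.2 y) := by
    refine dense_of_mem_residual ((countable_bInter_mem (Set.to_countable _)).2 fun q hq =>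
      (countable_bInter_mem (htc q.1 hq q.2)).2 fun y _ => ?_)
    exact residual_of_dense_open (hO q.1 hq q.2 y) (hOd q.1 hq q.2 y)
  refine hdense.mono fun f hf h hh c y => ?_
  have hy : y ∈ ⋃ x ∈ t h c, N h c x := by rw [ht h hh c]; trivial
  obtain ⟨x, hx, hyx⟩ := Set.mem_iUnion₂.1 hy
  exact hsep h hh c x f (Set.mem_iInter₂.1 (Set.mem_iInter₂.1 hf (h, c) hh) x hx) y hyx

/-- The controlled marker property: an open set with disjoint translates over a box, such that
`D + 1` shifts of its translates over the difference set of the box cover the space. -/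
theorem IsFreeAction.exists_open_marker {S : Flow (Fin k → ℤ) Y} (hS : IsFreeAction S)
    (hk : 0 < k) {D : ℕ} (hD : coveringDim Y ≤ D) {N : ℕ} (hN : 0 < N) :
    ∃ (W : Set Y) (m : Fin (D + 1) → Fin k → ℤ), IsOpen W ∧
      (∀ g : Fin k → ℤ, (∀ a, |g a| < N) → g ≠ 0 → ∀ y ∈ W, S g y ∉ W) ∧
      ∀ y, ∃ l, ∃ g : Fin k → ℤ, (∀ a, |g a| < N) ∧ S (g + m l) y ∈ W := by
  have hfin : {g : Fin k → ℤ | ∀ a, |g a| < N}.Finite := by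
    refine (Set.finite_Icc (fun _ => -(N : ℤ)) (fun _ => (N : ℤ))).subset fun g hg => ?_
    exact ⟨fun a => (abs_lt.1 (hg a)).1.le, fun a => (abs_lt.1 (hg a)).2.le⟩
  have hfin' : Finite {g : Fin k → ℤ // ∀ a, |g a| < N} := hfin.to_subtype
  have hloc : ∀ y : Y, ∃ r > 0, ∀ g : Fin k → ℤ, (∀ a, |g a| < N) → g ≠ 0 →
      ∀ x ∈ Metric.closedBall y (2 * r), S g x ∉ Metric.closedBall y (2 * r) := by
    intro y
    have hy : IsTowerBase S (fun g : {g : Fin k → ℤ // ∀ a, |g a| < N} => (g : Fin k → ℤ))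
        (fun _ => ()) {y} := by
      rintro j j' hj - x rfl x' rfl
      exact fun e => hj (Subtype.ext (hS.injective _ e))
    obtain ⟨r, hr, htow⟩ := exists_closedBall_isTowerBase S _ _ (Set.toFinite _) hy
    rw [Set.biUnion_singleton] at htow
    refine ⟨r / 2, half_pos hr, fun g hg hg0 x hx hgx => ?_⟩
    rw [mul_div_cancel₀ r two_ne_zero] at hx hgx
    refine htow ⟨g, hg⟩ ⟨0, by simpa using fun _ => hN⟩ (by simpa using hg0) rfl x hx _ hgx ?_
    exact (S.map_zero_apply _).symm
  choose r hr hrd using hloc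
  obtain ⟨t, ht⟩ := isCompact_univ.elim_finite_subcover (fun y => Metric.ball y (r y))
    (fun y => Metric.isOpen_ball) (fun y _ => Set.mem_iUnion.2 ⟨y, by simpa using hr y⟩)
  obtain ⟨δ, hδr, hδ⟩ : ∃ δ : ℝ, (∀ i : t, δ ≤ r i / 2) ∧ 0 < δ := by
    refine Eventually.exists (f := 𝓝[>] (0 : ℝ)) (Eventually.and ?_ self_mem_nhdsWithin)
    rw [eventually_all]
    intro i
    filter_upwards [Ioc_mem_nhdsGT (half_pos (hr i))] with δ hδ using hδ.2
  -- The radius `3 r / 2` lies between `r` and `2 r`: after a perturbation of size `δ / 2 ≤ r / 4`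
  -- the positivity set still contains the ball of radius `r` and stays in that of radius `2 r`.
  let φ₀ : C(Y, t → ℝ) := ⟨fun y i => 3 * r i / 2 - dist y i, by fun_prop⟩
  obtain ⟨φ, hφ, hφd⟩ := dense_continuousMap_iff.1
    (hS.dense_forall_exists_ne_zero hD (ι := t)) φ₀ (δ / 2) (half_pos hδ)
  have hφd' : ∀ y (i : t), |φ y i - (3 * r i / 2 - dist y i)| ≤ δ / 2 := fun y i =>
    (dist_le_pi_dist (φ y) (φ₀ y) i).trans (hφd y)
  have hφc : ∀ i, Continuous fun y => φ y i := fun i => (continuous_apply i).comp φ.continuous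
  let V : t → Set Y := fun i => {y | 0 < φ y i}
  have hVb : ∀ i : t, V i ⊆ Metric.closedBall i (2 * r i) := by
    intro i y hy
    have h1 := abs_le.1 (hφd' y i)
    have h2 := hδr i
    have h3 : 0 < φ y i := hy
    rw [Metric.mem_closedBall]
    linarith
  obtain ⟨W, hWo, hWd, -, hWc⟩ := exists_greedy_union S hN V
    (fun i => isOpen_lt continuous_const (hφc i))
    (fun i g hg hg0 y hy hgy => hrd i g hg hg0 y (hVb i hy) (hVb i hgy)) Finset.univ
  set R : ℤ := (Finset.univ : Finset t).card * N with hR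
  have hR0 : 0 ≤ R := by positivity
  -- With spacing `2 R + 1`, displacements of size at most `R` cannot make times from different
  -- shifts coincide. If all shifts failed, the orbit would thus meet zero sets at `D + 1` distinct
  -- times.
  refine ⟨W, fun l => Pi.single ⟨0, hk⟩ ((l : ℕ) * (2 * R + 1)), hWo, hWd, fun y => ?_⟩
  by_contra! hcon
  have hbad : ∀ l : Fin (D + 1), ∃ i : t, ∃ g : Fin k → ℤ, (∀ a, |g a| ≤ R) ∧
      φ (S (g + Pi.single ⟨0, hk⟩ ((l : ℕ) * (2 * R + 1))) y) i = 0 := by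
    intro l
    set x := S (Pi.single ⟨0, hk⟩ ((l : ℕ) * (2 * R + 1))) y with hx
    obtain ⟨i, hi, hxi⟩ := Set.mem_iUnion₂.1 (ht (Set.mem_univ x))
    have hxV : x ∈ V ⟨i, hi⟩ := by
      have h1 := abs_le.1 (hφd' x ⟨i, hi⟩)
      have h2 := hδr ⟨i, hi⟩
      have h3 := Metric.mem_ball.1 hxi
      simp only at h1 h2
      change 0 < φ x ⟨i, hi⟩
      linarith
    rcases hWc ⟨i, hi⟩ (Finset.mem_univ _) x hxV with ⟨g, hg, hgx⟩ | ⟨i', g, hg, hgx⟩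
    · exact absurd (by rwa [S.map_add]) (hcon l g hg)
    · refine ⟨i', g, hg, ?_⟩
      rw [S.map_add]
      exact (frontier_lt_subset_eq continuous_const (hφc i') hgx).symm
  choose c g hg hφ0 using hbad
  have hinj : Function.Injective fun l : Fin (D + 1) =>
      g l + Pi.single ⟨0, hk⟩ (((l : ℕ) : ℤ) * (2 * R + 1)) := by
    intro l l' hll
    have h1 := congrFun hll ⟨0, hk⟩
    simp only [Pi.add_apply, Pi.single_eq_same] at h1
    have h2 := abs_le.1 (hg l ⟨0, hk⟩)
    have h3 := abs_le.1 (hg l' ⟨0, hk⟩)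
    have h4 : ((l : ℕ) : ℤ) - ((l' : ℕ) : ℤ) = 0 := by
      refine Int.abs_lt_one_iff.1 (abs_lt.2 ⟨?_, ?_⟩) <;> nlinarith
    exact Fin.ext (by omega)
  obtain ⟨l, hl⟩ := hφ _ hinj c y
  exact hl (hφ0 l)

/-- The marker can be taken closed. -/
theorem IsFreeAction.exists_closed_marker {S : Flow (Fin k → ℤ) Y} (hS : IsFreeAction S)
    (hk : 0 < k) {D : ℕ} (hD : coveringDim Y ≤ D) {N : ℕ} (hN : 0 < N) :
    ∃ (F : Set Y) (m : Fin (D + 1) → Fin k → ℤ), IsClosed F ∧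
      (∀ g : Fin k → ℤ, (∀ a, |g a| < N) → g ≠ 0 → ∀ y ∈ F, S g y ∉ F) ∧
      ∀ y, ∃ l, ∃ g : Fin k → ℤ, (∀ a, |g a| < N) ∧ S (g + m l) y ∈ F := by
  obtain ⟨W, m, hWo, hWd, hWc⟩ := hS.exists_open_marker hk hD hN
  choose l g hg hW using hWc
  -- By compactness finitely many closed balls inside `W` keep the covering property, and
  -- disjointness passes to subsets of `W`.
  have hball : ∀ y, ∃ r > 0, Metric.closedBall (S (g y + m (l y)) y) r ⊆ W := fun y =>
    Metric.nhds_basis_closedBall.mem_iff.1 (hWo.mem_nhds (hW y))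
  choose r hr hrW using hball
  have hS' : ∀ m, Continuous fun x => S m x := fun m => S.continuous_toFun m
  obtain ⟨t, ht⟩ := isCompact_univ.elim_finite_subcover
    (fun y => (fun x => S (g y + m (l y)) x) ⁻¹' Metric.ball (S (g y + m (l y)) y) (r y))
    (fun y => Metric.isOpen_ball.preimage (hS' _))
    (fun y _ => Set.mem_iUnion.2 ⟨y, by simpa using hr y⟩)
  refine ⟨⋃ y ∈ t, Metric.closedBall (S (g y + m (l y)) y) (r y), m,
    t.finite_toSet.isClosed_biUnion fun _ _ => Metric.isClosed_closedBall, ?_, fun x => ?_⟩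
  · have hsub : (⋃ y ∈ t, Metric.closedBall (S (g y + m (l y)) y) (r y)) ⊆ W :=
      Set.iUnion₂_subset fun y _ => hrW y
    exact fun g hg hg0 y hy hgy => hWd g hg hg0 y (hsub hy) (hsub hgy)
  · obtain ⟨y, hy, hxy⟩ := Set.mem_iUnion₂.1 (ht (Set.mem_univ x))
    exact ⟨l y, g y, hg y, Set.mem_iUnion₂.2 ⟨y, hy, Metric.ball_subset_closedBall hxy⟩⟩

end Free

/-! ### Embedding extensions of free finite-dimensional actions -/

theorem dist_le_boxDist {k : ℕ} {X : Type*} [MetricSpace X] (T : Flow (Fin k → ℤ) X) {n : ℕ}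
    (g : Fin k → Fin n) (x y : X) :
    dist (T (fun i => ((g i : ℕ) : ℤ)) x) (T (fun i => ((g i : ℕ) : ℤ)) y) ≤ boxDist T n x y :=
  le_ciSup (f := fun g : Fin k → Fin n =>
    dist (T (fun i => ((g i : ℕ) : ℤ)) x) (T (fun i => ((g i : ℕ) : ℤ)) y))
    (Set.finite_range _).bddAbove g

/-- A single good `N` is enough, and a lower limit below `L / 2` supplies it; `2 D < N ^ k * L` in
integers is the count needed for separation. -/
theorem exists_cover_of_meanDim_lt {k : ℕ} {X : Type*} [MetricSpace X] {T : Flow (Fin k → ℤ) X}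
    {L : ℕ} (hT : meanDim T < (L : ℝ≥0∞) / 2) {ε : ℝ} (hε : 0 < ε) :
    ∃ (N D : ℕ) (𝒰 : Set (Set X)), 0 < N ∧ 2 * D + 1 ≤ N ^ k * L ∧ IsFiniteOpenCover 𝒰 ∧
      coverOrder 𝒰 ≤ D ∧ ∀ U ∈ 𝒰, ∀ x ∈ U, ∀ y ∈ U, boxDist T N x y ≤ ε := by
  have h1 : liminf (fun n : ℕ => ((widim ε (boxDist T n) : ℕ∞) : ℝ≥0∞) / (n : ℝ≥0∞) ^ k) atTop
      < (L : ℝ≥0∞) / 2 :=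
    lt_of_le_of_lt (le_iSup₂ (f := fun (ε : ℝ) (_ : 0 < ε) =>
      liminf (fun n : ℕ => ((widim ε (boxDist T n) : ℕ∞) : ℝ≥0∞) / (n : ℝ≥0∞) ^ k) atTop) ε hε) hT
  obtain ⟨N, hN, hN0⟩ := ((frequently_lt_of_liminf_lt (by isBoundedDefault) h1).and_eventually
    (eventually_gt_atTop 0)).exists
  have hNk0 : (N : ℝ≥0∞) ^ k ≠ 0 := pow_ne_zero _ (by exact_mod_cast hN0.ne')
  have hNk : (N : ℝ≥0∞) ^ k ≠ ⊤ := ENNReal.pow_ne_top (ENNReal.natCast_ne_top N)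
  rw [ENNReal.div_lt_iff (Or.inl hNk0) (Or.inl hNk)] at hN
  have hw : widim ε (boxDist T N) ≠ ⊤ := by
    intro h
    rw [h] at hN
    exact not_top_lt hN
  obtain ⟨D, hD⟩ := ENat.ne_top_iff_exists.1 hw
  have hDN : 2 * D < N ^ k * L := by
    rw [← hD] at hN
    have h2 : (D : ℝ≥0∞) * 2 < L * N ^ k := by
      have h3 := (ENNReal.mul_lt_mul_iff_left (c := 2) (by norm_num) (by norm_num)).2 hN
      rw [mul_right_comm, ENNReal.div_mul_cancel (by norm_num) (by norm_num)] at h3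
      simpa using h3
    have h4 : D * 2 < L * N ^ k := by exact_mod_cast h2
    linarith
  have h5 : widim ε (boxDist T N) < (D + 1 : ℕ) := by
    rw [← hD]; exact_mod_cast D.lt_succ_self
  simp only [widim, iInf_lt_iff] at h5
  obtain ⟨𝒰, h𝒰, hdiam, hord⟩ := h5
  exact ⟨N, D, 𝒰, hN0, hDN, h𝒰, Order.le_of_lt_add_one (by exact_mod_cast hord), hdiam⟩

section Extension

variable {k : ℕ} {X Y : Type*} [MetricSpace X] [MetricSpace Y]

/-- The base of the tower of the colour `(l, b)` attached to a marker `F`. -/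
def towerBase (S : Flow (Fin k → ℤ) Y) (F : Set Y) {D : ℕ} (m : Fin (D + 1) → Fin k → ℤ) (N : ℕ)
    (c : Fin (D + 1) × (Fin k → Bool)) : Set Y :=
  {y | S ((fun a => if c.2 a then (N : ℤ) else 0) + m c.1) y ∈ F}

theorem isClosed_towerBase (S : Flow (Fin k → ℤ) Y) {F : Set Y} (hF : IsClosed F) {D : ℕ}
    (m : Fin (D + 1) → Fin k → ℤ) (N : ℕ) (c : Fin (D + 1) × (Fin k → Bool)) :
    IsClosed (towerBase S F m N c) := by
  have h : Continuous fun y => S ((fun a => if c.2 a then (N : ℤ) else 0) + m c.1) y :=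
    S.continuous_toFun _
  exact hF.preimage h

/-- The towers over the `2ᵏ (D + 1)` bases cover the space. -/
theorem exists_mem_towerBase (S : Flow (Fin k → ℤ) Y) {F : Set Y} {D : ℕ}
    {m : Fin (D + 1) → Fin k → ℤ} {N : ℕ} {y : Y}
    (hy : ∃ l, ∃ g : Fin k → ℤ, (∀ a, |g a| < N) ∧ S (g + m l) y ∈ F) :
    ∃ (c : Fin (D + 1) × (Fin k → Bool)) (n : Fin k → Fin N),
      S (-fun a => ((n a : ℕ) : ℤ)) y ∈ towerBase S F m N c := by
  obtain ⟨l, g, hg, hgy⟩ := hy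
  -- The interval `(-N, N)` splits into `(-N, 0]` and `(0, N)`; the bit `b` records the half, which
  -- produces the factor `2 ^ k`.
  have hbn : ∀ a, ∃ (b : Bool) (n : Fin N), g a = (if b then (N : ℤ) else 0) - ((n : ℕ) : ℤ) := by
    intro a
    have h1 := abs_lt.1 (hg a)
    by_cases h : g a ≤ 0
    · exact ⟨false, ⟨(-g a).toNat, by omega⟩, by simp; omega⟩
    · exact ⟨true, ⟨(N - g a).toNat, by omega⟩, by simp; omega⟩
  choose b n hbn using hbn
  refine ⟨(l, b), n, ?_⟩
  change S _ (S _ y) ∈ F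
  rw [← S.map_add]
  convert hgy using 2
  funext a
  simp only [Pi.add_apply, Pi.neg_apply, hbn a]
  ring

/-- A coincidence in `X` projects to `Y`, where it gives two points of `F` differing by `ν - ν'` in
`(-N, N)ᵏ`, so `ν = ν'`. -/
theorem isTowerBase_preimage_towerBase {T : Flow (Fin k → ℤ) X} {S : Flow (Fin k → ℤ) Y}
    {π : X → Y} (hπ : Flow.IsSemiconjugacy π T S) {F : Set Y} {D : ℕ}
    (m : Fin (D + 1) → Fin k → ℤ) {N L : ℕ}
    (hF : ∀ g : Fin k → ℤ, (∀ a, |g a| < N) → g ≠ 0 → ∀ y ∈ F, S g y ∉ F)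
    (c : Fin (D + 1) × (Fin k → Bool)) :
    IsTowerBase T (fun j : (Fin k → Fin N) × Fin L => fun a => ((j.1 a : ℕ) : ℤ)) (fun j => j.2)
      (π ⁻¹' towerBase S F m N c) := by
  rintro ⟨n, l⟩ ⟨n', l'⟩ hne hl x hx x' hx' heq
  simp only at hl heq
  set u : Fin k → ℤ := (fun a => if c.2 a then (N : ℤ) else 0) + m c.1 with hu
  have hx1 : S u (π x) ∈ F := hx
  have hx1' : S u (π x') ∈ F := hx'
  set ν : Fin k → ℤ := fun a => ((n a : ℕ) : ℤ)
  set ν' : Fin k → ℤ := fun a => ((n' a : ℕ) : ℤ)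
  have h1 : S ν (π x) = S ν' (π x') := by
    rw [← (hπ.semiconj ν).eq, ← (hπ.semiconj ν').eq, heq]
  have h2 : S (ν - ν') (S u (π x)) = S u (π x') := by
    rw [← S.map_add, show ν - ν' + u = u + -ν' + ν by abel, S.map_add, h1, ← S.map_add]
    congr 1
    abel
  refine hF (ν - ν') (fun a => ?_) (fun h0 => hne ?_) _ hx1 (h2 ▸ hx1')
  · have := (n a).2
    have := (n' a).2
    simp only [ν, ν', Pi.sub_apply]
    rw [abs_lt]
    constructor <;> omega
  · refine Prod.ext (funext fun a => Fin.ext ?_) hl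
    have := congrFun h0 a
    simp only [ν, ν', Pi.sub_apply, Pi.zero_apply] at this
    change (n a : ℕ) = n' a
    omega

/-- The sigmoid carries `ℝ` injectively into `[0,1]`, so real-valued observables may be used
throughout. -/
theorem embedsInto_cubicalShift {T : Flow (Fin k → ℤ) X} {ι : Type*} [Fintype ι] (f : C(X, ι → ℝ))
    (hf : ∀ x x', (∀ m, f (T m x) = f (T m x')) → x = x') {M : ℕ} (hM : Fintype.card ι = M) :
    EmbedsInto T (cubicalShift k M) := by
  let e := Fintype.equivFinOfCardEq hM
  refine ⟨fun x n i => unitInterval.sigmoid (f (T n x) (e.symm i)), ?_, fun x x' h => ?_, ?_⟩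
  · refine continuous_pi fun n => continuous_pi fun i => ?_
    have hc : Continuous fun x => T n x := T.continuous_toFun n
    have hc' : Continuous fun x => f (T n x) (e.symm i) :=
      (continuous_apply _).comp (f.continuous.comp hc)
    exact unitInterval.continuous_sigmoid.comp hc'
  · refine hf x x' fun m => funext fun i => ?_
    have := congrFun (congrFun h m) (e i)
    simpa using unitInterval.sigmoid_injective this
  · intro n x
    funext m i
    change _ = unitInterval.sigmoid (f (T (m + n) x) (e.symm i))
    rw [T.map_add]

variable [CompactSpace X]

theorem isOpen_separating_fibres {T : Flow (Fin k → ℤ) X} {π : X → Y} (hπ : Continuous π)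
    (ι : Type*) [Fintype ι] (ε : ℝ) :
    IsOpen {f : C(X, ι → ℝ) |
      ∀ p ∈ {p : X × X | π p.1 = π p.2 ∧ ε ≤ dist p.1 p.2}, ∃ m, f (T m p.1) ≠ f (T m p.2)} := by
  refine isOpen_setOf_forall_mem_of_isCompact (IsClosed.isCompact ?_)
    (R := fun (f : C(X, ι → ℝ)) (p : X × X) => ∃ m, f (T m p.1) ≠ f (T m p.2)) ?_
  · exact (isClosed_eq (hπ.comp continuous_fst) (hπ.comp continuous_snd)).inter
      (isClosed_le continuous_const continuous_dist)
  · simp only [Set.ofPred_exists]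
    refine isOpen_iUnion fun m => ?_
    have hc : Continuous fun x => T m x := T.continuous_toFun m
    exact isOpen_ne_fun (by fun_prop) (by fun_prop)

variable [CompactSpace Y]

/-- Generic functions separate, up to `ε`, the points of the fibres of the extension. -/
theorem dense_separating_fibres {T : Flow (Fin k → ℤ) X} {S : Flow (Fin k → ℤ) Y}
    {π : X → Y} (hπ : Flow.IsSemiconjugacy π T S) (hS : IsFreeAction S) (hk : 0 < k) {D L : ℕ}
    (hD : coveringDim Y ≤ D) (hT : meanDim T < (L : ℝ≥0∞) / 2) {ε : ℝ} (hε : 0 < ε) :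
    Dense {f : C(X, (Fin (D + 1) × (Fin k → Bool)) × Fin L → ℝ) |
      ∀ p ∈ {p : X × X | π p.1 = π p.2 ∧ ε ≤ dist p.1 p.2}, ∃ m, f (T m p.1) ≠ f (T m p.2)} := by
  rw [dense_continuousMap_iff]
  intro f δ hδ
  obtain ⟨η, hη, hfη⟩ := Metric.uniformContinuous_iff.1
    (CompactSpace.uniformContinuous_of_continuous f.continuous) (δ / 2) (half_pos hδ)
  -- The scale is below `ε` for the final separation and below `η` so that samples of `f` oscillate
  -- little; halving makes the bounds strict.
  obtain ⟨N, D', 𝒰, hN, hDN, h𝒰, hord, hdiam⟩ := exists_cover_of_meanDim_lt hT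
    (half_pos (lt_min hε hη))
  have hdist : ∀ U ∈ 𝒰, ∀ x ∈ U, ∀ y ∈ U, ∀ n : Fin k → Fin N,
      dist (T (fun a => ((n a : ℕ) : ℤ)) x) (T (fun a => ((n a : ℕ) : ℤ)) y) < min ε η :=
    fun U hU x hx y hy n => ((dist_le_boxDist T n x y).trans (hdiam U hU x hx y hy)).trans_lt
      (half_lt_self (lt_min hε hη))
  obtain ⟨F, m, hF, hFd, hFc⟩ := hS.exists_closed_marker hk hD hN
  let fc : Fin (D + 1) × (Fin k → Bool) → C(X, Fin L → ℝ) :=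
    fun c => ⟨fun x l => f x (c, l), by fun_prop⟩
  have hg : ∀ c, ∃ g : C(X, Fin L → ℝ), (∀ x, dist (g x) (fc c x) ≤ 2 * (δ / 2)) ∧
      ∀ x ∈ π ⁻¹' towerBase S F m N c, ∀ x' ∈ π ⁻¹' towerBase S F m N c,
        sample T (fun j : (Fin k → Fin N) × Fin L => fun a => ((j.1 a : ℕ) : ℤ)) (fun j => j.2) g x
        = sample T (fun j : (Fin k → Fin N) × Fin L => fun a => ((j.1 a : ℕ) : ℤ)) (fun j => j.2)
            g x' → ∃ U ∈ 𝒰, x ∈ U ∧ x' ∈ U := by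
    intro c
    refine exists_sample_separating T _ _ ((isClosed_towerBase S hF m N c).preimage hπ.cont)
      (isTowerBase_preimage_towerBase hπ m hFd c) (fc c) h𝒰 hord (by simpa using hDN)
      (half_pos hδ) fun U hU x hx y hy => ?_
    refine (dist_pi_le_iff (half_pos hδ).le).2 fun j => ?_
    rw [sample_apply, sample_apply]
    refine (dist_le_pi_dist (f _) (f _) (c, j.2)).trans (hfη ?_).le
    exact (hdist U hU x hx y hy j.1).trans_le (min_le_right _ _)
  choose g hg1 hg2 using hg
  refine ⟨⟨fun x q => g q.1 x q.2, by fun_prop⟩, ?_, fun x => ?_⟩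
  · rintro ⟨x, x'⟩ ⟨hπx, hxx⟩
    by_contra! hcon
    simp only at hπx hxx hcon
    -- Since `π x = π x'`, the same colour and level serve both points. Applying `T ν` after the
    -- comparison at the base recovers `dist x x' < ε`.
    obtain ⟨c, n, hcn⟩ := exists_mem_towerBase S (hFc (π x))
    set ν : Fin k → ℤ := fun a => ((n a : ℕ) : ℤ) with hν
    obtain ⟨U, hU, hxU, hxU'⟩ := hg2 c (T (-ν) x)
      (by rw [Set.mem_preimage, (hπ.semiconj _).eq]; exact hcn) (T (-ν) x')
      (by rw [Set.mem_preimage, (hπ.semiconj _).eq, ← hπx]; exact hcn) (by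
        funext j
        rw [sample_apply, sample_apply, ← T.map_add, ← T.map_add]
        exact congrFun (hcon _) (c, j.2))
    have h1 := hdist U hU _ hxU _ hxU' n
    rw [← hν, flow_apply_neg, flow_apply_neg] at h1
    exact absurd hxx (not_le.2 (h1.trans_le (min_le_left _ _)))
  · refine (dist_pi_le_iff hδ.le).2 fun q => ?_
    have h1 := (dist_le_pi_dist (g q.1 x) (fc q.1 x) q.2).trans (hg1 q.1 x)
    simpa [fc, mul_div_cancel₀ δ (two_ne_zero (α := ℝ))] using h1

theorem exists_separating_fibres {T : Flow (Fin k → ℤ) X} {S : Flow (Fin k → ℤ) Y}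
    {π : X → Y} (hπ : Flow.IsSemiconjugacy π T S) (hS : IsFreeAction S) (hk : 0 < k) {D L : ℕ}
    (hD : coveringDim Y ≤ D) (hT : meanDim T < (L : ℝ≥0∞) / 2) :
    ∃ f : C(X, (Fin (D + 1) × (Fin k → Bool)) × Fin L → ℝ),
      ∀ x x', π x = π x' → (∀ m, f (T m x) = f (T m x')) → x = x' := by
  obtain ⟨f, hf⟩ := (dense_iInter_of_isOpen
    (fun n : ℕ => isOpen_separating_fibres (T := T) hπ.cont
      ((Fin (D + 1) × (Fin k → Bool)) × Fin L) (1 / ((n : ℝ) + 1)))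
    (fun n : ℕ => dense_separating_fibres hπ hS hk hD hT (by positivity))).nonempty
  refine ⟨f, fun x x' hxx hm => ?_⟩
  by_contra hne
  obtain ⟨n, hn⟩ := exists_nat_one_div_lt (dist_pos.2 hne)
  obtain ⟨m, hm'⟩ := Set.mem_iInter.1 hf n (x, x') ⟨hxx, hn.le⟩
  exact hm' (hm m)

/-- Equal orbit data under `φ ∘ π` force the same fibre, and within a fibre `f` separates. -/
theorem embedsInto_of_isSemiconjugacy {T : Flow (Fin k → ℤ) X} {S : Flow (Fin k → ℤ) Y}
    {π : X → Y} (hπ : Flow.IsSemiconjugacy π T S) (hS : IsFreeAction S) (hk : 0 < k) {D L : ℕ}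
    (hD : coveringDim Y ≤ D) (hT : meanDim T < (L : ℝ≥0∞) / 2) :
    EmbedsInto T (cubicalShift k (1 + 2 ^ k * (D + 1) * L)) := by
  obtain ⟨φ, hφ⟩ := hS.exists_separating hk hD
  obtain ⟨f, hf⟩ := exists_separating_fibres hπ hS hk hD hT
  have hπc := hπ.cont
  refine embedsInto_cubicalShift
    (ι := Unit ⊕ ((Fin (D + 1) × (Fin k → Bool)) × Fin L))
    ⟨fun x => Sum.elim (φ (π x)) (f x), ?_⟩ (fun x x' h => ?_) ?_
  · refine continuous_pi ?_
    rintro (i | i)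
    · exact (continuous_apply i).comp (φ.continuous.comp hπc)
    · exact (continuous_apply i).comp f.continuous
  · refine hf x x' (hφ _ _ fun m => ?_) fun m => ?_
    · rw [← (hπ.semiconj m).eq, ← (hπ.semiconj m).eq]
      exact funext fun i => congrFun (h m) (Sum.inl i)
    · exact funext fun i => congrFun (h m) (Sum.inr i)
  · simp only [Fintype.card_sum, Fintype.card_prod, Fintype.card_unit, Fintype.card_fin,
      Fintype.card_pi, Fintype.card_bool, Finset.prod_const, Finset.card_univ]
    ring

end Extension

theorem mainTheorem6 (k : ℕ) (hk : 0 < k) (L : ℕ) (hL : 0 < L)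
    {X : Type*} [MetricSpace X] [CompactSpace X] (T : Flow (Fin k → ℤ) X)
    {Y : Type*} [MetricSpace Y] [CompactSpace Y] (S : Flow (Fin k → ℤ) Y)
    (π : X → Y) (hπ : Flow.IsSemiconjugacy π T S)
    (hfree : IsFreeAction S) (hdim : coveringDim Y ≠ ⊤)
    (hmdim : meanDim T < (L : ℝ≥0∞) / 2) :
    (∀ d : ℕ, coveringDim Y = d →
      EmbedsInto T (cubicalShift k (1 + 2 ^ k * (d + 1) * L))) ∧
    (∀ d : ℕ, coveringDim X = d →
      EmbedsInto T (cubicalShift k (1 + 2 ^ k * (d + 1) * L))) := by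
  refine ⟨fun d hd => embedsInto_of_isSemiconjugacy hπ hfree hk hd.le hmdim, fun d hd => ?_⟩
  -- Freeness lifts through `π`, so `X` can play the role of `Y` as an extension of itself.
  have hfreeT : IsFreeAction T := fun n x hx => hfree n (π x) (by
    rw [← (hπ.semiconj n).eq, hx])
  exact embedsInto_of_isSemiconjugacy ((Flow.isSemiconjugacy_id_iff_eq T T).2 rfl) hfreeT hk
    hd.le hmdim
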